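/- Let $X$ and $Z$ be real Hausdorff topological vector spaces, let $C\subseteq Z$ be a convex and pointed cone with nonempty interior (that is, $tc\in C$ for all $c\in C$, $t\ge 0$; $C+C=C$; $C\cap(-C)=\{0\}$; $\operatorname{int}C\neq\emptyset$), and let $K$ be a nonempty convex subset of $X$, not necessarily closed. For convex sets $U\subseteq V\subseteq X$ put $$\operatorname{core}_V U=\{u\in U:\ U\cap\,]u,v]\neq\emptyset\ \text{ for all } v\in V\},\qquad ]u,v]=\{u+t(v-u): t\in\,]0,1]\}.$$ Let $F:K\times K\times K\to Z$ be a mapping satisfying the following conditions. (i) For every $y\in K$ at least one of the following holds: (a) for every $x\in K$ and every net $(x_\alpha)\subseteq K$ with $\lim x_\alpha=x$: if $F(x_\alpha,y,x_\alpha)\notin-\operatorname{int}C$ for all $\alpha$, then $F(x,y,x)\notin-\operatorname{int}C$; (b) the mapping $x\mapsto F(x,y,x)$ is $C$-upper semicontinuous on $K$, i.e. for every $x\in K$ and every neighbourhood $V$ of $F(x,y,x)$ there is a neighbourhood $U$ of $x$ such that $F(u,y,u)\in V-C$ for all $u\in U\cap K$; (c) for every $x\in K$ and every net $(x_\alpha)\subseteq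 K$ with $\lim x_\alpha=x$ there is a net $(z_\alpha)\subseteq Z$, with the same index set, converging to some $z\in Z$ such that $F(x_\alpha,y,x_\alpha)-z_\alpha\in-C$ for all $\alpha$ and $F(x,y,x)-z\in C$. (ii) For every $x\in K$ the mapping $y\mapsto F(x,y,x)$ is $C$-convex, i.e. for all $y_1,y_2\in K$ and $t\in[0,1]$, $$tF(x,y_1,x)+(1-t)F(x,y_2,x)-F(x,ty_1+(1-t)y_2,x)\in C.$$ (iii) For every $x\in K$, $F(x,x,x)\in(-C)\setminus(-\operatorname{int}C)$. (iv) There is a nonempty compact convex subset $K_0$ of $K$ such that for every $x\in K_0\setminus\operatorname{core}_K K_0$ there exists $y_0\in\operatorname{core}_K K_0$ with $F(x,y_0,x)\in-C$. Then there exists $x_0\in K$ such that $F(x_0,y,x_0)\notin-\operatorname{int}C$ for all $y\in K$. -/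

import Mathlib

open Set Filter Topology
open scoped Pointwise

universe u v

/-- The half-open segment `]x, y] = {x + t (y - x) : t ∈ ]0, 1]}`. -/
def leftOpenSegment {X : Type u} [AddCommGroup X] [Module ℝ X] (x y : X) : Set X :=
  {z | ∃ t ∈ Ioc (0 : ℝ) 1, z = x + t • (y - x)}

/-- The algebraic interior of `U` relative to `V`: the points `u ∈ U` such that `U` meets
`]u, v]` for every `v ∈ V`. -/
def relCore {X : Type u} [AddCommGroup X] [Module ℝ X] (V U : Set X) : Set X :=
  {p ∈ U | ∀ v ∈ V, (U ∩ leftOpenSegment p v).Nonempty}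

/-- `f` is `C`-convex on `K`. Only the values of `f` on the convex set `K` matter. -/
def CConvexOn {X : Type u} {Z : Type v} [AddCommGroup X] [Module ℝ X]
    [AddCommGroup Z] [Module ℝ Z] (K : Set X) (C : Set Z) (f : X → Z) : Prop :=
  ∀ x ∈ K, ∀ y ∈ K, ∀ t ∈ Icc (0 : ℝ) 1,
    t • f x + (1 - t) • f y - f (t • x + (1 - t) • y) ∈ C

/-- `f : K → Z` is `C`-upper semicontinuous at every point of `K`: for each neighbourhood `V` of
`f x` there is a neighbourhood `U` of `x` with `f w ∈ V - C` for all `w ∈ U ∩ K`. -/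
def CUpperSemicontinuousOn {X : Type u} {Z : Type v} [TopologicalSpace X]
    [AddCommGroup Z] [TopologicalSpace Z] (K : Set X) (C : Set Z) (f : X → Z) : Prop :=
  ∀ x ∈ K, ∀ V ∈ 𝓝 (f x), ∃ U ∈ 𝓝 x, ∀ w ∈ U ∩ K, f w ∈ V - C

/-- For every net in `K` with limit `x ∈ K`: if `f (x_α) ∉ -int C` for all `α`, then
`f x ∉ -int C`. A net is a family indexed by a nonempty directed preorder. Index sets in the
universe of `X` suffice, since a closure point of a subset of `X` is the limit of a net in it
indexed by the neighbourhoods of the point. -/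
def NetClosedCondition {X : Type u} {Z : Type v} [TopologicalSpace X]
    [AddCommGroup Z] [TopologicalSpace Z] (K : Set X) (C : Set Z) (f : X → Z) : Prop :=
  ∀ (ι : Type u) [Preorder ι] [IsDirectedOrder ι] [Nonempty ι] (a : ι → X),
    (∀ i, a i ∈ K) → ∀ x ∈ K, Tendsto a atTop (𝓝 x) →
      (∀ i, f (a i) ∉ -interior C) → f x ∉ -interior C

/-- For every `x ∈ K` and every net `(x_α)` in `K` with limit `x` there is a net `(z_α)` in `Z`
with the same index set, convergent to some `z`, such that `f (x_α) - z_α ∈ -C` for all `α` and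
`f x - z ∈ C`. -/
def NetDominationCondition {X : Type u} {Z : Type v} [TopologicalSpace X]
    [AddCommGroup Z] [TopologicalSpace Z] (K : Set X) (C : Set Z) (f : X → Z) : Prop :=
  ∀ x ∈ K, ∀ (ι : Type u) [Preorder ι] [IsDirectedOrder ι] [Nonempty ι] (a : ι → X),
    (∀ i, a i ∈ K) → Tendsto a atTop (𝓝 x) →
      ∃ (b : ι → Z) (z : Z), Tendsto b atTop (𝓝 z) ∧ (∀ i, f (a i) - b i ∈ -C) ∧ f x - z ∈ C

/-! For fixed `y`, the points `x ∈ K` with `F x y x ∉ -int C` form a relatively closed subset of `K`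
(`notMem_neg_interior_of_mem_closure`). For fixed `x`, the `y` violating this form a convex set that
omits `x`. Ky Fan's argument (`IsCompact.exists_mem_forall_of_convex_compl`) therefore gives `x ∈
K₀` that solves the problem against all `y ∈ K₀`. To reach `y ∈ K`, take `p` in the core of `K₀`
with `F x p x ∈ -C`: either `x` itself by (iii), or the point supplied by (iv). If `F x y x ∈ -int
C`, then `C`-convexity puts all values on `]p, y]` in `-int C`, yet that segment meets `K₀`.

Compactness reduces Ky Fan's lemma to KKM on a simplex, which follows from Brouwer's theorem.
Brouwer is derived from Scarf's lemma, a parity argument on a finite set with several linear orders: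
ranking the grid points of a simplex by each coordinate produces approximate fixed points. -/

/-! ### Scarf's lemma -/

/-- A finset `σ` is dominant for the rankings `r i` if every point is ranked below all of `σ` by
at least one of them. -/
def Dominant {S I : Type*} (r : I → S → ℕ) (σ : Finset S) : Prop :=
  ∀ y, ∃ i, ∀ x ∈ σ, r i y ≤ r i x

theorem Dominant.mono {S I : Type*} {r : I → S → ℕ} {σ τ : Finset S} (h : Dominant r σ)
    (hτ : τ ⊆ σ) : Dominant r τ := fun y =>
  (h y).imp fun _ hi x hx => hi x (hτ hx)

/-- In a dominant set with one element less than there are rankings, exactly one pair of rankings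
has a common minimizer. -/
theorem Dominant.exists_common_min {S I : Type*} [Fintype I] {r : I → S → ℕ}
    (hr : ∀ i, Function.Injective (r i)) {τ : Finset S} (hτ : Dominant r τ)
    (hcard : τ.card + 1 = Fintype.card I) (hne : τ.Nonempty) :
    ∃ (m : I → S) (a b : I), (∀ i, m i ∈ τ) ∧ (∀ i, ∀ x ∈ τ, r i (m i) ≤ r i x) ∧ a ≠ b ∧
      m a = m b ∧ ∀ j, j = a ∨ j = b →
        (∀ i k, i ≠ j → k ≠ j → m i = m k → i = k) ∧ ∀ x ∈ τ, ∃ i, i ≠ j ∧ m i = x := by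
  classical
  choose m hm hmin using fun i => τ.exists_min_image (r i) hne
  -- Dominance at a point of `τ` makes it the minimizer of some ranking. So `m` maps onto a set with
  -- one element fewer than `I`, and exactly one fibre is a pair.
  have hsurj : ∀ x ∈ τ, ∃ i, m i = x := fun x hx => by
    obtain ⟨i, hi⟩ := hτ x
    exact ⟨i, hr i (le_antisymm (hmin i x hx) (hi _ (hm i)))⟩
  obtain ⟨a, -, b, -, hab, hmab⟩ :=
    Finset.exists_ne_map_eq_of_card_lt_of_maps_to (s := (Finset.univ : Finset I)) (t := τ)
      (by rw [Finset.card_univ]; omega) (f := m) (fun i _ => hm i)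
  refine ⟨m, a, b, hm, hmin, hab, hmab, fun j hj => ?_⟩
  have hs : ∀ x ∈ τ, ∃ i, i ≠ j ∧ m i = x := by
    intro x hx
    obtain ⟨i, rfl⟩ := hsurj x hx
    by_cases hij : i = j
    · subst hij
      rcases hj with rfl | rfl
      · exact ⟨b, hab.symm, hmab.symm⟩
      · exact ⟨a, hab, hmab⟩
    · exact ⟨i, hij, rfl⟩
  refine ⟨?_, hs⟩
  have himg : (Finset.univ.erase j).image m = τ := by
    ext x
    simp only [Finset.mem_image, Finset.mem_erase, Finset.mem_univ, and_true]
    exact ⟨fun ⟨i, _, hi⟩ => hi ▸ hm i, hs x⟩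
  have hinj : Set.InjOn m (Finset.univ.erase j : Finset I) := by
    rw [← Finset.card_image_iff, himg, Finset.card_erase_of_mem (Finset.mem_univ _),
      Finset.card_univ]
    omega
  intro i k hi hk h
  exact hinj (by simpa using hi) (by simpa using hk) h

/-- The dominant sets obtained by adding a point to a dominant set with one element less than
there are rankings: each of the two rankings `a`, `b` with a common minimizer gives exactly one
such point, provided that there is a point which all other rankings put above their minimizers. -/
theorem Dominant.extensions {S I : Type*} [Fintype S] [Fintype I] [DecidableEq S]
    {r : I → S → ℕ} (hr : ∀ i, Function.Injective (r i)) {τ : Finset S} (hτ : Dominant r τ)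
    (hcard : τ.card + 1 = Fintype.card I) (hne : τ.Nonempty) :
    ∃ (m : I → S) (a b : I), (∀ i, m i ∈ τ) ∧ (∀ i, ∀ x ∈ τ, r i (m i) ≤ r i x) ∧ a ≠ b ∧
      m a = m b ∧
      ∃ E : I → Finset (Finset S),
        (∀ σ, σ ∈ E a ∪ E b ↔ σ.card = Fintype.card I ∧ Dominant r σ ∧ τ ⊆ σ) ∧
        Disjoint (E a) (E b) ∧
        ∀ j, j = a ∨ j = b →
          ((∃ y, ∀ i, i ≠ j → r i (m i) < r i y) → (E j).card = 1) ∧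
          ((¬ ∃ y, ∀ i, i ≠ j → r i (m i) < r i y) → (E j).card = 0) := by
  classical
  obtain ⟨m, a, b, hm, hmin, hab, hmab, hmj⟩ := hτ.exists_common_min hr hcard hne
  -- `x` is the `r j`-highest of the points lying above the minimizers of all rankings except `j`.
  let P : I → S → Prop := fun j x =>
    (∀ i, i ≠ j → r i (m i) < r i x) ∧ ∀ y, (∀ i, i ≠ j → r i (m i) < r i y) → r j y ≤ r j x
  have hnot : ∀ j, j = a ∨ j = b → ∀ x, (∀ i, i ≠ j → r i (m i) < r i x) → x ∉ τ := by
    intro j hj x hx hxτ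
    obtain ⟨i, hij, rfl⟩ := (hmj j hj).2 x hxτ
    exact lt_irrefl _ (hx i hij)
  have hlt : ∀ y, ∃ i, r i y ≤ r i (m i) := fun y => (hτ y).imp fun i hi => hi _ (hm i)
  have huniq : ∀ j x x', P j x → P j x' → x = x' := fun j x x' h h' =>
    hr j (le_antisymm (h'.2 _ h.1) (h.2 _ h'.1))
  have hcardins : ∀ x, x ∉ τ → (insert x τ).card = Fintype.card I := fun x hx => by
    rw [Finset.card_insert_of_notMem hx, hcard]
  have hdom : ∀ j, j = a ∨ j = b → ∀ x, P j x → Dominant r (insert x τ) := by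
    intro j hj x hx y
    have hxj : r j x ≤ r j (m j) := by
      obtain ⟨i, hi⟩ := hlt x
      by_cases hij : i = j
      · exact hij ▸ hi
      · exact absurd (hx.1 i hij) (not_lt.2 hi)
    by_cases hy : ∀ i, i ≠ j → r i (m i) < r i y
    · refine ⟨j, fun z hz => ?_⟩
      rcases Finset.mem_insert.1 hz with rfl | hz
      · exact hx.2 y hy
      · exact (hx.2 y hy).trans (hxj.trans (hmin j z hz))
    · push Not at hy
      obtain ⟨i, hij, hi⟩ := hy
      refine ⟨i, fun z hz => ?_⟩
      rcases Finset.mem_insert.1 hz with rfl | hz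
      · exact hi.trans (hx.1 i hij).le
      · exact hi.trans (hmin i z hz)
  -- If `j` ranks `x` lowest, the other rankings must provide every point of `τ` as a minimizer. So
  -- `m` stays onto without `j`, which puts `j` in the double fibre.
  have hconv : ∀ x, x ∉ τ → Dominant r (insert x τ) → ∃ j, (j = a ∨ j = b) ∧ P j x := by
    intro x hxτ hd
    obtain ⟨j, hj⟩ := hd x
    have hs : ∀ t ∈ τ, ∃ i, i ≠ j ∧ m i = t ∧ r i t < r i x := by
      intro t ht
      obtain ⟨i, hi⟩ := hd t
      have htx : t ≠ x := fun h => hxτ (h ▸ ht)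
      have hix := hi x (Finset.mem_insert_self _ _)
      refine ⟨i, ?_, hr i (le_antisymm (hmin i t ht) (hi _ (Finset.mem_insert_of_mem (hm i)))),
        lt_of_le_of_ne hix fun h => htx (hr i h)⟩
      rintro rfl
      exact htx (hr i (le_antisymm hix (hj t (Finset.mem_insert_of_mem ht))))
    have hjab : j = a ∨ j = b := by
      by_contra hcon
      push Not at hcon
      obtain ⟨i, hij, hi, -⟩ := hs (m j) (hm j)
      by_cases hia : i = a
      · subst hia
        exact hij ((hmj b (Or.inr rfl)).1 _ _ hab hcon.2 hi)
      · exact hij ((hmj a (Or.inl rfl)).1 _ _ hia hcon.1 hi)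
    refine ⟨j, hjab, fun i hij => ?_, fun y hy => ?_⟩
    · obtain ⟨k, hkj, hk, hkx⟩ := hs (m i) (hm i)
      have := (hmj j hjab).1 _ _ hkj hij hk
      subst this
      exact hkx
    · obtain ⟨i, hi⟩ := hd y
      by_cases hij : i = j
      · exact hij ▸ hi x (Finset.mem_insert_self _ _)
      · exact absurd (hy i hij) (not_lt.2 (hi _ (Finset.mem_insert_of_mem (hm i))))
  refine ⟨m, a, b, hm, hmin, hab, hmab,
    fun j => (Finset.univ.filter (P j)).image fun x => insert x τ, ?_, ?_, ?_⟩
  · intro σ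
    simp only [Finset.mem_union, Finset.mem_image, Finset.mem_filter, Finset.mem_univ, true_and]
    constructor
    · rintro (⟨x, hx, rfl⟩ | ⟨x, hx, rfl⟩)
      · exact ⟨hcardins x (hnot a (Or.inl rfl) x hx.1), hdom a (Or.inl rfl) x hx,
          Finset.subset_insert _ _⟩
      · exact ⟨hcardins x (hnot b (Or.inr rfl) x hx.1), hdom b (Or.inr rfl) x hx,
          Finset.subset_insert _ _⟩
    · rintro ⟨hc, hd, hsub⟩
      have h1 : (σ \ τ).card = 1 := by rw [Finset.card_sdiff_of_subset hsub]; omega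
      obtain ⟨x, hx⟩ := Finset.card_eq_one.1 h1
      have hxτ : x ∉ τ := (Finset.mem_sdiff.1 (hx ▸ Finset.mem_singleton_self x)).2
      have hσ : insert x τ = σ := by
        rw [Finset.insert_eq, ← hx, Finset.sdiff_union_of_subset hsub]
      subst hσ
      obtain ⟨j, rfl | rfl, hP⟩ := hconv x hxτ hd
      · exact Or.inl ⟨x, hP, rfl⟩
      · exact Or.inr ⟨x, hP, rfl⟩
  · rw [Finset.disjoint_left]
    intro σ h1 h2
    simp only [Finset.mem_image, Finset.mem_filter, Finset.mem_univ, true_and] at h1 h2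
    obtain ⟨x, hx, rfl⟩ := h1
    obtain ⟨y, hy, hxy⟩ := h2
    have : x ∈ insert y τ := hxy ▸ Finset.mem_insert_self _ _
    rcases Finset.mem_insert.1 this with rfl | h
    · obtain ⟨i, hi⟩ := hlt x
      by_cases hia : i = a
      · exact absurd (hy.1 i (hia ▸ hab)) (not_lt.2 hi)
      · exact absurd (hx.1 i hia) (not_lt.2 hi)
    · exact hnot a (Or.inl rfl) x hx.1 h
  · intro j hj
    constructor
    · rintro ⟨y, hy⟩
      obtain ⟨x, hx, hmax⟩ := (Finset.univ.filter fun y => ∀ i, i ≠ j → r i (m i) < r i y)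
        |>.exists_max_image (r j) ⟨y, by simpa using hy⟩
      have hPx : P j x := ⟨by simpa using hx, fun y hy => hmax y (by simpa using hy)⟩
      refine Finset.card_eq_one.2 ⟨insert x τ, ?_⟩
      have : Finset.univ.filter (P j) = {x} := by
        ext z
        simp only [Finset.mem_filter, Finset.mem_univ, true_and, Finset.mem_singleton]
        exact ⟨fun h => huniq j _ _ h hPx, fun h => h ▸ hPx⟩
      simp only [this, Finset.image_singleton]
    · intro h
      rw [Finset.card_eq_zero, Finset.image_eq_empty, Finset.filter_eq_empty_iff]
      exact fun x _ hx => h ⟨x, hx.1⟩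

/-- If `σ` has as many points as there are colours but misses a colour, the number of its facets
with colour set `univ \ {i₀}` is even. -/
theorem even_card_facets {S I : Type*} [Fintype I] [DecidableEq S] [DecidableEq I]
    (c : S → I) (i₀ : I) (σ : Finset S) (hcard : σ.card = Fintype.card I)
    (hσ : σ.image c ≠ Finset.univ) :
    Even ((σ.filter fun x => (σ.erase x).image c = Finset.univ.erase i₀).card) := by
  rcases (σ.filter fun x => (σ.erase x).image c = Finset.univ.erase i₀).eq_empty_or_nonempty
    with h | ⟨x, hx⟩
  · simp [h]
  obtain ⟨hxσ, hx⟩ := Finset.mem_filter.1 hx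
  have hinj : Set.InjOn c (σ.erase x : Finset S) := by
    rw [← Finset.card_image_iff, hx, Finset.card_erase_of_mem (Finset.mem_univ _),
      Finset.card_erase_of_mem hxσ, hcard, Finset.card_univ]
  -- Colour `i₀` at `x` would complete the colours. Hence `x` repeats the colour of a single `x'`,
  -- and exactly the deletions of `x` and `x'` count.
  have hcx : c x ≠ i₀ := by
    intro h
    apply hσ
    rw [← Finset.insert_erase hxσ, Finset.image_insert, hx, h,
      Finset.insert_erase (Finset.mem_univ _)]
  obtain ⟨x', hx', hcx'⟩ : ∃ x' ∈ σ.erase x, c x' = c x := by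
    rw [← Finset.mem_image, hx]; simpa using hcx
  have hx'x := (Finset.mem_erase.1 hx').1
  have hx'σ := (Finset.mem_erase.1 hx').2
  have heq : (σ.filter fun x => (σ.erase x).image c = Finset.univ.erase i₀) = {x, x'} := by
    ext z
    simp only [Finset.mem_filter, Finset.mem_insert, Finset.mem_singleton]
    constructor
    · rintro ⟨hz, hzc⟩
      by_contra hcon
      push Not at hcon
      have hzx : z ∈ σ.erase x := Finset.mem_erase.2 ⟨hcon.1, hz⟩
      have : c z ∈ (σ.erase z).image c := by
        rw [hzc, ← hx]; exact Finset.mem_image_of_mem _ hzx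
      obtain ⟨w, hw, hwz⟩ := Finset.mem_image.1 this
      obtain ⟨hwne, hwσ⟩ := Finset.mem_erase.1 hw
      by_cases hwx : w = x
      · subst hwx
        exact hcon.2 (hinj hzx hx' (by rw [hcx', hwz]))
      · exact hwne (hinj (Finset.mem_coe.2 (Finset.mem_erase.2 ⟨hwx, hwσ⟩)) hzx hwz)
    · rintro (rfl | rfl)
      · exact ⟨hxσ, hx⟩
      · refine ⟨hx'σ, ?_⟩
        rw [← hx]
        have e1 : σ.erase z = insert x ((σ.erase x).erase z) := by
          rw [Finset.erase_right_comm, Finset.insert_erase]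
          exact Finset.mem_erase.2 ⟨hx'x.symm, hxσ⟩
        conv_rhs => rw [← Finset.insert_erase hx']
        rw [e1, Finset.image_insert, Finset.image_insert, hcx']
  rw [heq, Finset.card_pair hx'x.symm]
  exact even_two

/-- Scarf's lemma: if every ranking `r i` has a least element `e i` and puts the `e j`, `j ≠ i`,
above all other points, then for each colouring with `c (e i) = i` there is a dominant set with
as many points as there are rankings, and containing every colour. -/
theorem exists_dominant_image_eq_univ {S I : Type*} [Fintype S] [Fintype I] [DecidableEq S]
    [DecidableEq I] [Nontrivial I] {r : I → S → ℕ} (hr : ∀ i, Function.Injective (r i))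
    (e : I → S) (hmin : ∀ i y, y ≠ e i → r i (e i) < r i y)
    (hmax : ∀ i j, j ≠ i → ∀ y, (∀ k, y ≠ e k) → r i y < r i (e j))
    (c : S → I) (hc : ∀ i, c (e i) = i) :
    ∃ σ : Finset S, Dominant r σ ∧ σ.image c = Finset.univ := by
  classical
  by_contra hcon
  push Not at hcon
  obtain ⟨i₀⟩ : Nonempty I := inferInstance
  have he : Function.Injective e := Function.LeftInverse.injective hc
  have hI : 1 < Fintype.card I := Fintype.one_lt_card
  -- Count the pairs `τ ⊆ σ` with `τ ∈ D`, `σ ∈ R` twice: `τ₀` lies in one `σ` and every other `τ`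
  -- in two, so the total is odd; but each `σ`, missing a colour, contains an even number of `τ`.
  let R : Finset (Finset S) :=
    Finset.univ.filter fun σ => σ.card = Fintype.card I ∧ Dominant r σ
  let D : Finset (Finset S) := Finset.univ.filter fun τ =>
    τ.card + 1 = Fintype.card I ∧ Dominant r τ ∧ τ.image c = Finset.univ.erase i₀
  let τ₀ : Finset S := (Finset.univ.erase i₀).image e
  have hτ₀c : τ₀.image c = Finset.univ.erase i₀ := by
    simp only [τ₀, Finset.image_image]
    have : c ∘ e = id := funext hc
    rw [this, Finset.image_id]
  have hτ₀ : τ₀ ∈ D := by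
    refine Finset.mem_filter.2 ⟨Finset.mem_univ _, ?_, ?_, hτ₀c⟩
    · rw [Finset.card_image_of_injective _ he, Finset.card_erase_of_mem (Finset.mem_univ _),
        Finset.card_univ]
      omega
    · intro y
      by_cases hy : ∃ k, y = e k
      · obtain ⟨k, rfl⟩ := hy
        refine ⟨k, fun x _ => ?_⟩
        by_cases hx : x = e k
        · rw [hx]
        · exact (hmin k x hx).le
      · push Not at hy
        refine ⟨i₀, fun x hx => ?_⟩
        obtain ⟨j, hj, rfl⟩ := Finset.mem_image.1 hx
        exact (hmax i₀ j (Finset.ne_of_mem_erase hj) y hy).le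
  have hE : ∀ τ ∈ D, ((R.filter fun σ => τ ⊆ σ).card = if τ = τ₀ then 1 else 2) := by
    intro τ hτ
    obtain ⟨-, hcard, hdom, hcol⟩ := Finset.mem_filter.1 hτ
    have hne : τ.Nonempty := Finset.card_pos.1 (by omega)
    obtain ⟨m, a, b, hm, hmτ, hab, hmab, E, hEm, hEd, hEc⟩ := hdom.extensions hr hcard hne
    have hset : (R.filter fun σ => τ ⊆ σ) = E a ∪ E b := by
      ext σ
      rw [hEm]
      simp [R, and_assoc]
    rw [hset, Finset.card_union_of_disjoint hEd]
    split_ifs with hττ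
    · subst hττ
      have hmk : ∀ k, k ≠ i₀ → m k = e k := by
        intro k hk
        by_contra hne'
        exact absurd (hmin k (m k) hne') (not_lt.2 (hmτ k _ (Finset.mem_image_of_mem _
          (Finset.mem_erase.2 ⟨hk, Finset.mem_univ _⟩))))
      -- Ranking `i₀` yields an extension, witnessed by `e i₀`. Its partner `j` yields none: a point
      -- above `e j` in ranking `i₀` is some `e k` with `k ≠ i₀, j`, and this is not above its own
      -- minimizer `m k = e k`.
      have key1 : (∃ y, ∀ i, i ≠ i₀ → r i (m i) < r i y) :=
        ⟨e i₀, fun i hi => by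
          rw [hmk i hi]; exact hmin i _ fun h => hi (he h).symm⟩
      have key0 : ∀ j, j ≠ i₀ → m i₀ = m j → ¬ ∃ y, ∀ i, i ≠ j → r i (m i) < r i y := by
        rintro j hj hmj ⟨y, hy⟩
        have h0 := hy i₀ hj.symm
        rw [hmj, hmk j hj] at h0
        by_cases hyk : ∃ k, y = e k
        · obtain ⟨k, rfl⟩ := hyk
          by_cases hk0 : k = i₀
          · subst hk0
            exact absurd h0 (not_lt.2 (hmin k _ fun h => hj (he h)).le)
          · by_cases hkj : k = j
            · subst hkj; exact lt_irrefl _ h0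
            · have := hy k hkj
              rw [hmk k hk0] at this
              exact lt_irrefl _ this
        · push Not at hyk
          exact absurd h0 (not_lt.2 (hmax i₀ j hj y hyk).le)
      by_cases ha : a = i₀
      · subst ha
        rw [(hEc a (Or.inl rfl)).1 key1, (hEc b (Or.inr rfl)).2 (key0 b hab.symm hmab)]
      · by_cases hb : b = i₀
        · subst hb
          rw [(hEc b (Or.inr rfl)).1 key1, (hEc a (Or.inl rfl)).2 (key0 a hab hmab.symm)]
        · exact absurd (he (by rw [← hmk a ha, ← hmk b hb, hmab])) hab
    -- The witness `e j` can fail only if some `m i` is an `e k` with `k ≠ i`; then `τ` consists of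
    -- the `e l` with `l ≠ i`, and its colours force `τ = τ₀`.
    · have key : ∀ j, j = a ∨ j = b → ∃ y, ∀ i, i ≠ j → r i (m i) < r i y := by
        intro j hj
        refine ⟨e j, fun i hij => ?_⟩
        by_cases hmi : ∃ k, m i = e k
        · obtain ⟨k, hk⟩ := hmi
          by_cases hki : k = i
          · rw [hk, hki]; exact hmin i _ fun h => hij (he h).symm
          · exfalso
            have hsub : τ ⊆ (Finset.univ.erase i).image e := by
              intro t ht
              have h1 := hmτ i t ht
              rw [hk] at h1
              by_cases htl : ∃ l, t = e l
              · obtain ⟨l, rfl⟩ := htl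
                refine Finset.mem_image_of_mem _ (Finset.mem_erase.2 ⟨?_, Finset.mem_univ _⟩)
                rintro rfl
                exact absurd (hmin l (e k) fun h => hki (he h)) (not_lt.2 h1)
              · push Not at htl
                exact absurd (hmax i k hki t htl) (not_lt.2 h1)
            have heq : τ = (Finset.univ.erase i).image e := by
              refine Finset.eq_of_subset_of_card_le hsub ?_
              rw [Finset.card_image_of_injective _ he,
                Finset.card_erase_of_mem (Finset.mem_univ _), Finset.card_univ]
              omega
            have h2 : τ.image c = Finset.univ.erase i := by
              rw [heq, Finset.image_image, show c ∘ e = id from funext hc, Finset.image_id]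
            have h3 : i = i₀ := by
              by_contra hne'
              have : i ∈ Finset.univ.erase i₀ := by simpa using hne'
              rw [← hcol, h2] at this
              exact Finset.notMem_erase _ _ this
            exact hττ (by rw [heq, h3])
        · push Not at hmi
          exact hmax i j hij.symm _ hmi
      rw [(hEc a (Or.inl rfl)).1 (key a (Or.inl rfl)), (hEc b (Or.inr rfl)).1 (key b (Or.inr rfl))]
  have hodd : Odd (∑ τ ∈ D, (R.filter fun σ => τ ⊆ σ).card) := by
    rw [Finset.sum_congr rfl hE, ← Finset.add_sum_erase _ _ hτ₀, if_pos rfl]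
    refine odd_one.add_even (Finset.even_sum _ fun τ hτ => ?_)
    rw [if_neg (Finset.ne_of_mem_erase hτ)]
    exact even_two
  have heven : Even (∑ σ ∈ R, (D.filter fun τ => τ ⊆ σ).card) := by
    refine Finset.even_sum _ fun σ hσ => ?_
    obtain ⟨-, hcard, hdom⟩ := Finset.mem_filter.1 hσ
    have := even_card_facets c i₀ σ hcard (hcon σ hdom)
    refine (congrArg Even ?_).mpr this
    symm
    refine Finset.card_bij (fun x _ => σ.erase x) ?_ ?_ ?_
    · intro x hx
      obtain ⟨hx, hxc⟩ := Finset.mem_filter.1 hx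
      refine Finset.mem_filter.2 ⟨Finset.mem_filter.2 ⟨Finset.mem_univ _, ?_,
        hdom.mono (Finset.erase_subset _ _), hxc⟩, Finset.erase_subset _ _⟩
      rw [Finset.card_erase_of_mem hx]; omega
    · intro x hx y hy hxy
      by_contra hne
      have : y ∈ σ.erase x := Finset.mem_erase.2 ⟨Ne.symm hne, (Finset.mem_filter.1 hy).1⟩
      simp only [hxy] at this
      exact Finset.notMem_erase _ _ this
    · intro τ hτ
      obtain ⟨hτ, hsub⟩ := Finset.mem_filter.1 hτ
      obtain ⟨-, hτc, -, hcol⟩ := Finset.mem_filter.1 hτ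
      have h1 : (σ \ τ).card = 1 := by rw [Finset.card_sdiff_of_subset hsub]; omega
      obtain ⟨x, hx⟩ := Finset.card_eq_one.1 h1
      obtain ⟨hxσ, hxτ⟩ := Finset.mem_sdiff.1 (hx ▸ Finset.mem_singleton_self x)
      have hτx : σ.erase x = τ := by
        rw [Finset.erase_eq, ← hx, Finset.sdiff_sdiff_eq_self hsub]
      exact ⟨x, Finset.mem_filter.2 ⟨hxσ, hτx ▸ hcol⟩, hτx⟩
  have hdc := Finset.sum_card_bipartiteAbove_eq_sum_card_bipartiteBelow
    (s := D) (t := R) (fun τ σ : Finset S => τ ⊆ σ)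
  simp only [Finset.bipartiteAbove, Finset.bipartiteBelow] at hdc
  rw [hdc] at hodd
  exact (Nat.not_even_iff_odd.2 hodd) heven

/-! ### From Scarf's lemma to Brouwer and KKM -/

/-- A labelling of the grid points of denominator `N` of a simplex has a point `z` near which
every label `i` occurs, unless the coordinate `z i` is small. -/
theorem exists_grid_point_near_labels {I : Type*} [Fintype I] [Nontrivial I] (N : ℕ)
    (P : (I → ℕ) → I → Prop) (hP : ∀ x, ∑ i, x i = N → ∃ i, P x i) :
    ∃ z : I → ℕ, ∑ i, z i = N ∧ ∀ i, z i ≤ Fintype.card I ∨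
      ∃ x : I → ℕ, ∑ i, x i = N ∧ P x i ∧
        ∀ k, z k ≤ x k + Fintype.card I ∧ x k ≤ z k + Fintype.card I := by
  classical
  let T := {x : I → ℕ // x ∈ Finset.piAntidiag Finset.univ N}
  let _ : Fintype T := inferInstanceAs (Fintype {x // x ∈ Finset.piAntidiag Finset.univ N})
  have hT : ∀ x : T, ∑ i, x.1 i = N := fun x => (Finset.mem_piAntidiag.1 x.2).1
  choose c hc using fun x : T => hP x.1 (hT x)
  let n := Fintype.card T
  let q : T ≃ Fin n := Fintype.equivFin T
  let w : I ≃ Fin (Fintype.card I) := Fintype.equivFin I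
  -- Grid points are ordered by coordinate `i`, with ties broken by `q`. The shift by 1 reserves
  -- rank 0 for the adjoined point `i`; the other adjoined points come above the whole grid.
  let r : I → T ⊕ I → ℕ := fun i => Sum.elim (fun x => 1 + (x.1 i * n + q x))
    (fun j => if j = i then 0 else 1 + ((N + 1) * n + w j))
  have hle : ∀ (x : T) i, x.1 i ≤ N := fun x i =>
    (Finset.single_le_sum (f := x.1) (fun _ _ => Nat.zero_le _) (Finset.mem_univ i)).trans_eq (hT x)
  have hbd : ∀ (x : T) i, x.1 i * n + q x < (N + 1) * n := fun x i => by
    have h1 := Nat.mul_le_mul_right n (hle x i)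
    have h2 := (q x).2
    rw [add_mul]; omega
  have hr : ∀ i, Function.Injective (r i) := by
    rintro i (x | j) (y | k) h
    · simp only [r, Sum.elim_inl] at h
      have h' : x.1 i * n + q x = y.1 i * n + q y := by omega
      have := congrArg (· % n) h'
      simp only [Nat.mul_add_mod_self_right, Nat.mod_eq_of_lt (q x).2,
        Nat.mod_eq_of_lt (q y).2] at this
      rw [q.injective (Fin.ext this)]
    · simp only [r, Sum.elim_inl, Sum.elim_inr] at h
      have := hbd x i
      split_ifs at h <;> omega
    · simp only [r, Sum.elim_inl, Sum.elim_inr] at h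
      have := hbd y i
      split_ifs at h <;> omega
    · simp only [r, Sum.elim_inr] at h
      split_ifs at h with h1 h2 h2
      · rw [h1, h2]
      · omega
      · omega
      · have hw : (w j : ℕ) = w k := by omega
        rw [w.injective (Fin.ext hw)]
  obtain ⟨σ, hσ, hcol⟩ := exists_dominant_image_eq_univ hr (Sum.inr : I → T ⊕ I)
    (by
      rintro i (x | j) h
      · simp only [r, Sum.elim_inl, Sum.elim_inr]; simp
      · have : j ≠ i := fun hj => h (by rw [hj])
        simp [r, this])
    (by
      rintro i j hj (x | k) h
      · simp only [r, Sum.elim_inl, Sum.elim_inr, if_neg hj]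
        have := hbd x i
        omega
      · exact absurd rfl (h k))
    (Sum.elim c id) (fun _ => rfl)
  let C : Finset I := Finset.univ.filter fun i => (Sum.inr i : T ⊕ I) ∉ σ
  let A : Finset T := Finset.univ.filter fun x => (Sum.inl x : T ⊕ I) ∈ σ
  have hA : ∀ x, x ∈ A ↔ (Sum.inl x : T ⊕ I) ∈ σ := fun x => by simp [A]
  have hCA : ∀ i ∈ C, ∃ x ∈ A, c x = i := by
    intro i hi
    have : i ∈ σ.image (Sum.elim c id) := hcol ▸ Finset.mem_univ i
    obtain ⟨s | j, hs, rfl⟩ := Finset.mem_image.1 this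
    · exact ⟨s, (hA s).2 hs, rfl⟩
    · exact absurd hs (Finset.mem_filter.1 hi).2
  have hdomC : ∀ y : T, ∃ i ∈ C, ∀ x ∈ A, y.1 i ≤ x.1 i := by
    intro y
    obtain ⟨i, hi⟩ := hσ (Sum.inl y)
    refine ⟨i, Finset.mem_filter.2 ⟨Finset.mem_univ _, fun hiσ => ?_⟩, fun x hx => ?_⟩
    · have := hi _ hiσ
      simp [r] at this
    · have := hi _ ((hA x).1 hx)
      simp only [r, Sum.elim_inl] at this
      by_contra hlt
      push Not at hlt
      have h1 := Nat.mul_le_mul_right n hlt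
      have h2 := (q x).2
      rw [Nat.succ_mul] at h1
      omega
  have hmem : ∀ y : I → ℕ, ∑ i, y i = N → y ∈ Finset.piAntidiag Finset.univ N := fun y hy =>
    Finset.mem_piAntidiag.2 ⟨hy, fun i _ => Finset.mem_univ i⟩
  obtain ⟨i₁, hi₁, -⟩ := hdomC ⟨Pi.single (Classical.arbitrary I) N, hmem _ (by simp)⟩
  obtain ⟨z, hz, -⟩ := hCA i₁ hi₁
  choose m hmA hm using fun i => A.exists_min_image (fun x => x.1 i) ⟨z, hz⟩
  -- Otherwise some grid point exceeds the minimum over `A` in every coordinate of `C` (the surplus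
  -- goes to `i₁`), against `hdomC`. Since points of `A` have coordinate sum `N`, this leaves each
  -- coordinate little room above its minimum.
  have hsum : N < ∑ i ∈ C, ((m i).1 i + 1) := by
    by_contra hcon
    push Not at hcon
    let y : I → ℕ := fun i => (if i ∈ C then (m i).1 i + 1 else 0) +
      Pi.single (M := fun _ => ℕ) i₁ (N - ∑ i ∈ C, ((m i).1 i + 1)) i
    have hy : ∑ i, y i = N := by
      simp only [y, Finset.sum_add_distrib, Finset.sum_pi_single', Finset.mem_univ, if_true,
        Finset.sum_ite_mem, Finset.univ_inter]
      rw [← Finset.sum_add_distrib]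
      omega
    obtain ⟨i, hi, h⟩ := hdomC ⟨y, hmem y hy⟩
    have := h _ (hmA i)
    simp only [y, if_pos hi] at this
    omega
  rw [Finset.sum_add_distrib, Finset.sum_const, smul_eq_mul, mul_one] at hsum
  have hCcard : C.card ≤ Fintype.card I := Finset.card_le_univ _
  have hbound : ∀ x ∈ A, ∀ k, x.1 k ≤ Fintype.card I + if k ∈ C then (m k).1 k else 0 := by
    intro x hx k
    have h1 : ∑ i ∈ C.erase k, (m i).1 i ≤ ∑ i ∈ C.erase k, x.1 i :=
      Finset.sum_le_sum fun i _ => hm i x hx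
    have h2 : x.1 k + ∑ i ∈ C.erase k, x.1 i ≤ N := by
      refine le_trans ?_ ((Finset.add_sum_erase _ _ (Finset.mem_univ k)).trans (hT x)).le
      exact Nat.add_le_add_left (Finset.sum_le_sum_of_subset
        (Finset.erase_subset_erase _ (Finset.subset_univ _))) _
    split_ifs with hk
    · rw [← Finset.add_sum_erase _ _ hk] at hsum
      omega
    · rw [Finset.erase_eq_of_notMem hk] at h1 h2
      omega
  have hclose : ∀ x ∈ A, ∀ y ∈ A, ∀ k, x.1 k ≤ y.1 k + Fintype.card I := by
    intro x hx y hy k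
    have h1 := hbound x hx k
    have h2 := hm k y hy
    split_ifs at h1 <;> omega
  refine ⟨z.1, hT z, fun i => ?_⟩
  by_cases hi : i ∈ C
  · obtain ⟨x, hx, rfl⟩ := hCA i hi
    exact Or.inr ⟨x.1, hT x, hc x, fun k => ⟨hclose z hz x hx k, hclose x hx z hz k⟩⟩
  · have := hbound z hz i
    rw [if_neg hi] at this
    exact Or.inl this

/-- Label `i` is allowed at `x` when `x i ≤ f x i`; some label is, because both sides sum to 1. On a
fine grid, uniform continuity carries the inequality from the labelled points to `z`, and where `z
i` is small it holds because `f z i ≥ 0`. -/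
theorem exists_approx_fixedPoint_stdSimplex {I : Type*} [Fintype I] [Nontrivial I]
    {f : (I → ℝ) → I → ℝ} (hf : ContinuousOn f (stdSimplex ℝ I))
    (hmaps : MapsTo f (stdSimplex ℝ I) (stdSimplex ℝ I)) {ε : ℝ} (hε : 0 < ε) :
    ∃ z ∈ stdSimplex ℝ I, ∀ i, z i ≤ f z i + ε := by
  obtain ⟨δ, hδ, huc⟩ := Metric.uniformContinuousOn_iff.1
    ((isCompact_stdSimplex ℝ I).uniformContinuousOn_of_continuous hf) (ε / 2) (half_pos hε)
  obtain ⟨N, hN⟩ := exists_nat_gt ((Fintype.card I : ℝ) / min δ (ε / 2))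
  have hmin : 0 < min δ (ε / 2) := lt_min hδ (half_pos hε)
  have hNpos : (0 : ℝ) < N := lt_of_le_of_lt (by positivity) hN
  have hsmall : (Fintype.card I : ℝ) / N < min δ (ε / 2) := by
    rw [div_lt_iff₀ hmin] at hN
    rw [div_lt_iff₀ hNpos]
    linarith
  have hsδ := hsmall.trans_le (min_le_left _ _)
  have hsε := hsmall.trans_le (min_le_right _ _)
  let p : (I → ℕ) → I → ℝ := fun x i => x i / N
  have hp : ∀ x : I → ℕ, ∑ i, x i = N → p x ∈ stdSimplex ℝ I := by
    intro x hx
    refine ⟨fun i => by positivity, ?_⟩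
    simp only [p]
    rw [← Finset.sum_div, ← Nat.cast_sum, hx, div_self hNpos.ne']
  obtain ⟨z, hz, h⟩ := exists_grid_point_near_labels N (fun x i => p x i ≤ f (p x) i) (by
    intro x hx
    by_contra hcon
    push Not at hcon
    have := Finset.sum_lt_sum_of_nonempty (s := Finset.univ) Finset.univ_nonempty
      (fun i _ => hcon i)
    rw [(hmaps (hp x hx)).2, (hp x hx).2] at this
    exact lt_irrefl _ this)
  have hcast : ∀ a b : ℕ, a ≤ b + Fintype.card I →
      (a : ℝ) / N ≤ b / N + Fintype.card I / N := by
    intro a b hab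
    rw [← add_div]
    gcongr
    exact_mod_cast hab
  refine ⟨p z, hp z hz, fun i => ?_⟩
  rcases h i with h | ⟨x, hx, hPx, hclose⟩
  · have h1 := hcast (z i) 0 (by omega)
    have h2 := (hmaps (hp z hz)).1 i
    simp only [p] at h2 ⊢
    simp only [Nat.cast_zero, zero_div, zero_add] at h1
    linarith
  · have hd : dist (p x) (p z) < δ := by
      rw [dist_pi_lt_iff hδ]
      intro k
      have h1 := hcast _ _ (hclose k).1
      have h2 := hcast _ _ (hclose k).2
      rw [Real.dist_eq, abs_lt]
      simp only [p]
      constructor <;> linarith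
    have h3 := (dist_le_pi_dist _ _ i).trans_lt (huc _ (hp x hx) _ (hp z hz) hd)
    rw [Real.dist_eq, abs_lt] at h3
    have h1 := hcast _ _ (hclose i).1
    simp only [p] at hPx h3 ⊢
    linarith

/-- Brouwer's fixed point theorem for the standard simplex. -/
theorem exists_fixedPoint_stdSimplex {I : Type*} [Fintype I] [Nonempty I]
    {f : (I → ℝ) → I → ℝ} (hf : ContinuousOn f (stdSimplex ℝ I))
    (hmaps : MapsTo f (stdSimplex ℝ I) (stdSimplex ℝ I)) :
    ∃ x ∈ stdSimplex ℝ I, f x = x := by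
  classical
  have hne : (stdSimplex ℝ I).Nonempty :=
    ⟨_, single_mem_stdSimplex ℝ (Classical.arbitrary I)⟩
  rcases subsingleton_or_nontrivial I with hI | hI
  · obtain ⟨x, hx⟩ := hne
    refine ⟨x, hx, funext fun i => ?_⟩
    have h1 := (hmaps hx).2
    have h2 := hx.2
    rw [Fintype.sum_subsingleton _ i] at h1 h2
    rw [h1, h2]
  -- The total excess of `x` over `f x`. Approximate fixed points make its minimum 0, and equal
  -- coordinate sums then turn `x ≤ f x` into equality.
  let g : (I → ℝ) → ℝ := fun x => ∑ i, max (x i - f x i) 0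
  have hg : ContinuousOn g (stdSimplex ℝ I) := by
    refine continuousOn_finsetSum _ fun i _ => ContinuousOn.sup ?_ continuousOn_const
    exact (continuous_apply i).continuousOn.sub (continuousOn_pi.1 hf i)
  obtain ⟨x, hx, hmin⟩ := (isCompact_stdSimplex ℝ I).exists_isMinOn hne hg
  have hgx : g x ≤ 0 := by
    by_contra hcon
    push Not at hcon
    have hn : (0 : ℝ) < Fintype.card I := by exact_mod_cast Fintype.card_pos
    obtain ⟨z, hz, h⟩ := exists_approx_fixedPoint_stdSimplex hf hmaps
      (ε := g x / (2 * Fintype.card I)) (by positivity)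
    have h1 : g z ≤ ∑ _i : I, g x / (2 * Fintype.card I) :=
      Finset.sum_le_sum fun i _ => max_le (by linarith [h i]) (by positivity)
    rw [Finset.sum_const, Finset.card_univ, nsmul_eq_mul] at h1
    have h2 : (Fintype.card I : ℝ) * (g x / (2 * Fintype.card I)) = g x / 2 := by field_simp
    have h3 : g x ≤ g z := hmin hz
    linarith
  have hle : ∀ i, x i ≤ f x i := by
    intro i
    have h1 := Finset.single_le_sum (f := fun i => max (x i - f x i) 0)
      (fun i _ => le_max_right _ _) (Finset.mem_univ i)
    have h2 := le_max_left (x i - f x i) 0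
    simp only [g] at hgx
    linarith
  refine ⟨x, hx, funext fun i => ?_⟩
  have := (Finset.sum_eq_sum_iff_of_le (s := Finset.univ) (fun i _ => hle i)).1
    (by rw [hx.2, (hmaps hx).2])
  exact (this i (Finset.mem_univ i)).symm

/-- The Knaster–Kuratowski–Mazurkiewicz lemma. -/
theorem kkm_stdSimplex {I : Type*} [Fintype I] [Nonempty I] (A : I → Set (I → ℝ))
    (hA : ∀ i, IsClosed (A i))
    (hcover : ∀ x ∈ stdSimplex ℝ I, ∃ i, 0 < x i ∧ x ∈ A i) :
    ∃ x ∈ stdSimplex ℝ I, ∀ i, x ∈ A i := by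
  classical
  by_contra hcon
  push Not at hcon
  -- `Metric.infDist` to the empty set is 0, so nonemptiness is needed for positivity; vertex `i`
  -- can only be covered by `A i`.
  have hne : ∀ i, (A i).Nonempty := by
    intro i
    obtain ⟨j, hj, h⟩ := hcover _ (single_mem_stdSimplex ℝ i)
    by_cases hij : j = i
    · exact ⟨_, hij ▸ h⟩
    · simp [hij] at hj
  have hnn : ∀ x i, 0 ≤ Metric.infDist x (A i) := fun x i => Metric.infDist_nonneg
  have hpos : ∀ x ∈ stdSimplex ℝ I, 0 < ∑ i, Metric.infDist x (A i) := by
    intro x hx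
    obtain ⟨i, hi⟩ := hcon x hx
    exact Finset.sum_pos' (fun i _ => hnn x i)
      ⟨i, Finset.mem_univ i, ((hA i).notMem_iff_infDist_pos (hne i)).1 hi⟩
  -- The covering hypothesis gives a positive coordinate of the fixed point at which this map
  -- vanishes.
  obtain ⟨x, hx, hfx⟩ := exists_fixedPoint_stdSimplex
    (f := fun x i => Metric.infDist x (A i) / ∑ i, Metric.infDist x (A i)) (by
      refine continuousOn_pi.2 fun i => ContinuousOn.div ?_ ?_ fun x hx => (hpos x hx).ne'
      · exact (Metric.continuous_infDist_pt _).continuousOn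
      · exact (continuous_finsetSum _ fun i _ => Metric.continuous_infDist_pt _).continuousOn)
    (by
      intro x hx
      refine ⟨fun i => div_nonneg (hnn x i) (hpos x hx).le, ?_⟩
      rw [← Finset.sum_div, div_self (hpos x hx).ne'])
  obtain ⟨i, hi, hxi⟩ := hcover x hx
  have := congrFun hfx i
  simp only [Metric.infDist_zero_of_mem hxi, zero_div] at this
  exact hi.ne this

/-! ### Nets, cones and `C`-convex maps -/

/-- Neighbourhoods under reverse inclusion index the net, which keeps it in the universe over which
the net conditions quantify. -/
theorem exists_net_of_mem_closure {X : Type u} [TopologicalSpace X] {s : Set X} {x : X}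
    (hx : x ∈ closure s) :
    ∃ (ι : Type u) (_ : Preorder ι) (_ : IsDirectedOrder ι) (_ : Nonempty ι) (a : ι → X),
      (∀ i, a i ∈ s) ∧ Tendsto a atTop (𝓝 x) := by
  choose a ha using fun U : {U : Set X // U ∈ 𝓝 x}ᵒᵈ =>
    mem_closure_iff_nhds.1 hx (OrderDual.ofDual U).1 (OrderDual.ofDual U).2
  have hdir : IsDirectedOrder {U : Set X // U ∈ 𝓝 x}ᵒᵈ :=
    ⟨fun U V => ⟨OrderDual.toDual ⟨(OrderDual.ofDual U).1 ∩ (OrderDual.ofDual V).1,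
      inter_mem (OrderDual.ofDual U).2 (OrderDual.ofDual V).2⟩, inter_subset_left,
      inter_subset_right⟩⟩
  have hne : Nonempty {U : Set X // U ∈ 𝓝 x}ᵒᵈ := ⟨OrderDual.toDual ⟨univ, univ_mem⟩⟩
  refine ⟨_, inferInstance, hdir, hne, a, fun U => (ha U).2, fun V hV => ?_⟩
  refine mem_map.2 (mem_of_superset (Ici_mem_atTop (OrderDual.toDual ⟨V, hV⟩)) fun U hU => ?_)
  have hUV : (OrderDual.ofDual U).1 ⊆ V := hU
  exact hUV (ha U).1

theorem PointedCone.real_smul_mem {Z : Type v} [AddCommGroup Z] [Module ℝ Z]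
    (C : PointedCone ℝ Z) {t : ℝ} (ht : 0 ≤ t) {a : Z} (ha : a ∈ (C : Set Z)) :
    t • a ∈ (C : Set Z) :=
  Submodule.smul_mem C (⟨t, ht⟩ : {c : ℝ // 0 ≤ c}) ha

section Cone

variable {Z : Type v} [AddCommGroup Z] [Module ℝ Z] [TopologicalSpace Z]
  [IsTopologicalAddGroup Z]

/-- `int C + C` lies in the interior of `C + C ⊆ C`. -/
theorem PointedCone.add_mem_neg_interior (C : PointedCone ℝ Z) {a b : Z}
    (ha : a ∈ -interior (C : Set Z)) (hb : b ∈ -(C : Set Z)) :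
    a + b ∈ -interior (C : Set Z) := by
  rw [Set.mem_neg, neg_add]
  refine interior_mono ?_ (subset_interior_add_left (Set.add_mem_add ha hb))
  rintro _ ⟨p, hp, q, hq, rfl⟩
  exact C.add_mem hp hq

theorem PointedCone.smul_mem_neg_interior [ContinuousSMul ℝ Z] (C : PointedCone ℝ Z) {t : ℝ}
    (ht : 0 < t) {a : Z} (ha : a ∈ -interior (C : Set Z)) : t • a ∈ -interior (C : Set Z) := by
  rw [Set.mem_neg, ← smul_neg]
  have h : t • -a ∈ interior (t • (C : Set Z)) := by
    rw [interior_smul₀ ht.ne']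
    exact Set.smul_mem_smul_set ha
  refine interior_mono ?_ h
  rintro _ ⟨p, hp, rfl⟩
  exact C.real_smul_mem ht.le hp

/-- A `C`-convex map which takes a value in `-int C` at `y` and one in `-C` at `p` takes values in
`-int C` on `]p, y]`. -/
theorem CConvexOn.mem_neg_interior [ContinuousSMul ℝ Z] {X : Type u}
    [AddCommGroup X] [Module ℝ X] {C : PointedCone ℝ Z} {K : Set X} {g : X → Z} (hg : CConvexOn K (C : Set Z) g) {p y w : X}
    (hp : p ∈ K) (hy : y ∈ K) (hgp : g p ∈ -(C : Set Z))
    (hgy : g y ∈ -interior (C : Set Z)) (hw : w ∈ leftOpenSegment p y) :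
    g w ∈ -interior (C : Set Z) := by
  obtain ⟨t, ht, rfl⟩ := hw
  -- `g w` is `t • g y + (1 - t) • g p` minus an element of `C`. As `t > 0`, the first term lies in
  -- `-int C`, which absorbs the rest.
  have h := hg y hy p hp t ⟨ht.1.le, ht.2⟩
  have e : t • y + (1 - t) • p = p + t • (y - p) := by module
  rw [e] at h
  have h1 : (1 - t) • g p ∈ -(C : Set Z) := by
    rw [Set.mem_neg, ← smul_neg]
    exact C.real_smul_mem (sub_nonneg.2 ht.2) hgp
  have h2 := C.add_mem_neg_interior
    (C.add_mem_neg_interior (C.smul_mem_neg_interior ht.1 hgy) h1) (b := -_)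
    (by simpa only [Set.mem_neg, neg_neg] using h)
  convert h2 using 1
  abel

theorem CConvexOn.convex_mem_neg_interior [ContinuousSMul ℝ Z] {X : Type u}
    [AddCommGroup X] [Module ℝ X] {C : PointedCone ℝ Z} {K : Set X} (hK : Convex ℝ K) {g : X → Z}
    (hg : CConvexOn K (C : Set Z) g) : Convex ℝ {y ∈ K | g y ∈ -interior (C : Set Z)} := by
  rw [convex_iff_segment_subset]
  rintro p ⟨hp, hgp⟩ y ⟨hy, hgy⟩ w hw
  refine ⟨hK.segment_subset hp hy hw, ?_⟩
  rw [segment_eq_image'] at hw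
  obtain ⟨t, ht, rfl⟩ := hw
  rcases ht.1.eq_or_lt with rfl | h0
  · simpa using hgp
  · exact hg.mem_neg_interior hp hy
      (Set.neg_subset_neg.2 interior_subset hgp) hgy ⟨t, ⟨h0, ht.2⟩, rfl⟩

/-- This is what the three continuity alternatives share. Under (b), `-int C` is a neighbourhood of
`f x` unchanged by subtracting `C`. Under (c), `f x ∈ -int C` forces `z`, then some `b i`, then `f
(a i)` into `-int C`. -/
theorem notMem_neg_interior_of_mem_closure {X : Type u} [TopologicalSpace X]
    (C : PointedCone ℝ Z) {K : Set X} {f : X → Z}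
    (h : NetClosedCondition K (C : Set Z) f ∨ CUpperSemicontinuousOn K (C : Set Z) f ∨
      NetDominationCondition K (C : Set Z) f) {x : X} (hx : x ∈ K)
    (hcl : x ∈ closure {w ∈ K | f w ∉ -interior (C : Set Z)}) :
    f x ∉ -interior (C : Set Z) := by
  have hopen : IsOpen (-interior (C : Set Z)) := isOpen_interior.neg
  rcases h with h | h | h
  · obtain ⟨ι, _, _, _, a, ha, hlim⟩ := exists_net_of_mem_closure hcl
    exact h ι a (fun i => (ha i).1) x hx hlim fun i => (ha i).2
  · intro hfx
    obtain ⟨U, hU, hUK⟩ := h x hx _ (hopen.mem_nhds hfx)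
    obtain ⟨w, hwU, hwK, hw⟩ := mem_closure_iff_nhds.1 hcl U hU
    obtain ⟨p, hp, q, hq, hpq⟩ := hUK w ⟨hwU, hwK⟩
    apply hw
    rw [← hpq]
    simp only [sub_eq_add_neg]
    exact C.add_mem_neg_interior hp (by simpa only [Set.mem_neg, neg_neg] using hq)
  · intro hfx
    obtain ⟨ι, _, _, _, a, ha, hlim⟩ := exists_net_of_mem_closure hcl
    obtain ⟨b, z, hb, hab, hz⟩ := h x hx ι a (fun i => (ha i).1) hlim
    have hzC : z ∈ -interior (C : Set Z) := by
      have := C.add_mem_neg_interior hfx (b := -(f x - z))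
        (by simpa only [Set.mem_neg, neg_neg] using hz)
      simpa using this
    obtain ⟨i, hi⟩ := (hb.eventually (hopen.mem_nhds hzC)).exists
    apply (ha i).2
    have := C.add_mem_neg_interior hi (hab i)
    simpa using this

end Cone

/-! ### Ky Fan's lemma and the equilibrium theorem -/

/-- Ky Fan's form of the KKM lemma, for sections with convex complements: if `G y` is closed, the
points `y` with `x ∉ G y` form a convex set, and `x ∈ G x`, then the `G y` have a common point. -/
theorem IsCompact.exists_mem_forall_of_convex_compl {X : Type u} [AddCommGroup X] [Module ℝ X]
    [TopologicalSpace X] [IsTopologicalAddGroup X] [ContinuousSMul ℝ X] {K : Set X}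
    (hK : IsCompact K) (hKne : K.Nonempty) (hKconv : Convex ℝ K) (G : X → Set X)
    (hG : ∀ y ∈ K, IsClosed (G y)) (hconv : ∀ x ∈ K, Convex ℝ {y ∈ K | x ∉ G y})
    (hdiag : ∀ x ∈ K, x ∈ G x) : ∃ x ∈ K, ∀ y ∈ K, x ∈ G y := by
  classical
  have key := hK.inter_iInter_nonempty (fun y : K => G y) (fun y => hG y y.2) (fun s => by
    rcases s.eq_empty_or_nonempty with rfl | hs
    · simpa using hKne
    have : Nonempty s := hs.to_subtype
    let φ : (s → ℝ) → X := fun t => ∑ i, t i • (i.1 : X)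
    have hφ : Continuous φ := by fun_prop
    have hφK : ∀ t ∈ stdSimplex ℝ s, φ t ∈ K := fun t ht =>
      hKconv.sum_mem (fun i _ => ht.1 i) ht.2 fun i _ => i.1.2
    obtain ⟨t, ht, h⟩ := kkm_stdSimplex (fun i : s => φ ⁻¹' G (i.1 : X))
      (fun i => (hG _ i.1.2).preimage hφ) (by
        intro t ht
        -- If `φ t` missed `G y` for every `y` of positive weight, it would, as a convex combination
        -- of these `y`, lie in the convex set of `hconv`, against `hdiag`.
        by_contra hcon
        push Not at hcon
        have hsum : φ t = ∑ i ∈ Finset.univ.filter fun i => 0 < t i, t i • (i.1 : X) := by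
          refine (Finset.sum_subset (Finset.subset_univ _) fun i _ hi => ?_).symm
          have : t i = 0 := le_antisymm (by simpa using hi) (ht.1 i)
          rw [this, zero_smul]
        have hone : ∑ i ∈ Finset.univ.filter (fun i => 0 < t i), t i = 1 := by
          rw [← ht.2]
          refine Finset.sum_subset (Finset.subset_univ _) fun i _ hi => ?_
          exact le_antisymm (by simpa using hi) (ht.1 i)
        have := (hconv _ (hφK t ht)).sum_mem (t := Finset.univ.filter fun i => 0 < t i)
          (w := t) (z := fun i => (i.1 : X)) (fun i _ => ht.1 i) hone
          fun i hi => ⟨i.1.2, hcon i (Finset.mem_filter.1 hi).2⟩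
        rw [← hsum] at this
        exact this.2 (hdiag _ (hφK t ht)))
    exact ⟨φ t, hφK t ht, mem_iInter₂.2 fun i hi => h ⟨i, hi⟩⟩)
  obtain ⟨x, hx, h⟩ := key
  exact ⟨x, hx, fun y hy => mem_iInter.1 h ⟨y, hy⟩⟩

theorem theorem3p4 {X : Type u} {Z : Type v}
    [AddCommGroup X] [Module ℝ X] [TopologicalSpace X] [IsTopologicalAddGroup X]
    [ContinuousSMul ℝ X] [T2Space X]
    [AddCommGroup Z] [Module ℝ Z] [TopologicalSpace Z] [IsTopologicalAddGroup Z]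
    [ContinuousSMul ℝ Z] [T2Space Z]
    -- a convex cone containing the origin, with `C ∩ (-C) = {0}` and nonempty interior
    (C : PointedCone ℝ Z) (hCpointed : (C : Set Z) ∩ -(C : Set Z) = {0})
    (hCint : (interior (C : Set Z)).Nonempty)
    (K : Set X) (hKne : K.Nonempty) (hKconv : Convex ℝ K)
    -- only the values of `F` on `K × K × K` are used
    (F : X → X → X → Z)
    (hclosed : ∀ y ∈ K,
      NetClosedCondition K (C : Set Z) (fun x => F x y x) ∨
      CUpperSemicontinuousOn K (C : Set Z) (fun x => F x y x) ∨
      NetDominationCondition K (C : Set Z) (fun x => F x y x))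
    (hconvex : ∀ x ∈ K, CConvexOn K (C : Set Z) (fun y => F x y x))
    (hdiag : ∀ x ∈ K, F x x x ∈ (-(C : Set Z)) \ (-interior (C : Set Z)))
    (hcoercive : ∃ K₀ : Set X, K₀ ⊆ K ∧ K₀.Nonempty ∧ IsCompact K₀ ∧ Convex ℝ K₀ ∧
      ∀ x ∈ K₀ \ relCore K K₀, ∃ y₀ ∈ relCore K K₀, F x y₀ x ∈ -(C : Set Z)) :
    ∃ x₀ ∈ K, ∀ y ∈ K, F x₀ y x₀ ∉ -interior (C : Set Z) := by
  obtain ⟨K₀, hK₀K, hK₀ne, hK₀c, hK₀conv, hcore⟩ := hcoercive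
  have hsub : ∀ y, {w ∈ K₀ | F w y w ∉ -interior (C : Set Z)} ⊆
      {w ∈ K | F w y w ∉ -interior (C : Set Z)} := fun _ _ hw => ⟨hK₀K hw.1, hw.2⟩
  obtain ⟨x, hx, hxG⟩ := hK₀c.exists_mem_forall_of_convex_compl hK₀ne hK₀conv
    (fun y => closure {w ∈ K₀ | F w y w ∉ -interior (C : Set Z)}) (fun _ _ => isClosed_closure)
    (fun x hx => by
      -- Taking closures changes nothing at points of `K₀`: `x` avoids the closure for `y` exactly
      -- when `F x y x ∈ -int C`.
      have h := (hK₀conv.inter ((hconvex x (hK₀K hx)).convex_mem_neg_interior hKconv))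
      convert h using 1
      ext y
      simp only [mem_ofPred_eq, mem_inter_iff]
      refine and_congr_right fun hy => ⟨fun hc => ⟨hK₀K hy, ?_⟩, fun hc hcl => ?_⟩
      · by_contra hF
        exact hc (subset_closure ⟨hx, hF⟩)
      · exact notMem_neg_interior_of_mem_closure C (hclosed y (hK₀K hy)) (hK₀K hx)
          (closure_mono (hsub y) hcl) hc.2)
    (fun x hx => subset_closure ⟨hx, (hdiag x (hK₀K hx)).2⟩)
  have hxF : ∀ y ∈ K₀, F x y x ∉ -interior (C : Set Z) := fun y hy =>
    notMem_neg_interior_of_mem_closure C (hclosed y (hK₀K hy)) (hK₀K hx)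
      (closure_mono (hsub y) (hxG y hy))
  obtain ⟨p, hp, hFp⟩ : ∃ p ∈ relCore K K₀, F x p x ∈ -(C : Set Z) := by
    by_cases hxc : x ∈ relCore K K₀
    · exact ⟨x, hxc, (hdiag x (hK₀K hx)).1⟩
    · exact hcore x ⟨hx, hxc⟩
  refine ⟨x, hK₀K hx, fun y hy hFy => ?_⟩
  obtain ⟨w, hw, hwseg⟩ := hp.2 y hy
  exact hxF w hw ((hconvex x (hK₀K hx)).mem_neg_interior (hK₀K hp.1) hy hFp hFy hwseg)
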